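/- For an integer $m\ge 1$ and a set $S\subseteq\mathbb{Z}_m$, let the cyclic Haar graph $H(m;S)$ be the simple graph with vertex set $\{u_i, v_i : i\in\mathbb{Z}_m\}$ and edge set $\{u_iv_{i+c} : i\in\mathbb{Z}_m,\ c\in S\}$. Let $G=H(m;S)$ be a connected cyclic Haar graph with $|S|\ge 4$. If $m$ is a product of at most three prime powers, then $G$ is hamiltonian, that is, $G$ has a cycle containing all of its vertices. -/

import Mathlib

/-- The cyclic Haar graph `H(m; S)`: its vertices are `u_i = Sum.inl i` and `v_i = Sum.inr i` for
`i ∈ ℤ/m`, and its edges are the pairs `u_i v_{i + c}` with `i ∈ ℤ/m` and `c ∈ S`. -/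
def cyclicHaarGraph (m : ℕ) (S : Finset (ZMod m)) : SimpleGraph (ZMod m ⊕ ZMod m) where
  Adj x y := ∃ i : ZMod m, ∃ c ∈ S,
    (x = Sum.inl i ∧ y = Sum.inr (i + c)) ∨ (y = Sum.inl i ∧ x = Sum.inr (i + c))
  symm := ⟨fun _ _ ⟨i, c, hc, h⟩ => ⟨i, c, hc, h.symm⟩⟩
  loopless := ⟨by rintro (x | x) ⟨i, c, -, ⟨h, h'⟩ | ⟨h, h'⟩⟩ <;> simp_all⟩

/-- `m` is a product of at most three prime powers (the empty product being `1`). -/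
def IsProductOfAtMostThreePrimePowers (m : ℕ) : Prop :=
  ∃ L : Multiset ℕ, L.card ≤ 3 ∧ (∀ q ∈ L, IsPrimePow q) ∧ L.prod = m

/-! Connectedness makes `S` nonconstant modulo every prime divisor of `m`. As at most three primes
occur, two elements of `S` can be separated modulo two of them at once (with 2 among these if `m` is
even), and a third element deals with the last prime. This yields `x`, `x + a`, `x + b` in `S` such
that `a`, `b` generate `ℤ/m` and `⟨a⟩` has odd index `2q + 1`. These three labels already suffice: a
Hamilton cycle is the connected complement of a perfect matching in the cubic graph.

The cosets `j b + ⟨a⟩` form columns, with `(2q + 1) b = s a`. Collapsing all columns onto column 0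
leaves a Haar graph over `ℤ/n`, `n` the order of `a`, with labels `0, 1, c`. Its obvious Hamilton
cycle never uses label 2; a parity argument on 3-edge-colourings (`exists_second_label`) gives one
that does. In `labelGraph_column_connected` each label-2 edge of that cycle expands to a path
through all columns. Columns 1 to `2q` are traversed in pairs, each pair shifting by -1, whence the
odd index and `c = s - q`. -/

/-- The graph on two copies of `G` whose edges are the pairs `u_i v_{i + τ l}` with `l ≠ lab i`:
the cubic graph with connection labels `τ` after the edges chosen by `lab` are removed. -/
def labelGraph {G : Type*} [AddCommGroup G] (τ : Fin 3 → G) (lab : G → Fin 3) :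
    SimpleGraph (G ⊕ G) where
  Adj x y := ∃ i l, l ≠ lab i ∧
    ((x = Sum.inl i ∧ y = Sum.inr (i + τ l)) ∨ (y = Sum.inl i ∧ x = Sum.inr (i + τ l)))
  symm := ⟨fun _ _ ⟨i, c, hc, h⟩ => ⟨i, c, hc, h.symm⟩⟩
  loopless := ⟨by rintro (x | x) ⟨i, c, -, ⟨h, h'⟩ | ⟨h, h'⟩⟩ <;> simp_all⟩

theorem labelGraph_adj {G : Type*} [AddCommGroup G] {τ : Fin 3 → G} {lab : G → Fin 3}
    {i : G} {l : Fin 3} (h : l ≠ lab i) :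
    (labelGraph τ lab).Adj (Sum.inl i) (Sum.inr (i + τ l)) :=
  ⟨i, l, h, Or.inl ⟨rfl, rfl⟩⟩

theorem Fin.ncard_ne (x : Fin 3) : {l : Fin 3 | l ≠ x}.ncard = 2 := by
  have h : {l : Fin 3 | l ≠ x} = ((Finset.univ.erase x : Finset (Fin 3)) : Set (Fin 3)) := by
    ext; simp
  rw [h, Set.ncard_coe_finset, Finset.card_erase_of_mem (Finset.mem_univ _)]
  simp

theorem labelGraph_ncard_neighborSet {G : Type*} [AddCommGroup G] {τ : Fin 3 → G} {lab : G → Fin 3}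
    (hτ : Function.Injective τ) (hlab : Function.Bijective fun i => i + τ (lab i)) :
    ∀ x, ((labelGraph τ lab).neighborSet x).ncard = 2 := by
  rintro (i | y)
  · have h : (labelGraph τ lab).neighborSet (Sum.inl i)
        = (fun l => Sum.inr (i + τ l)) '' {l : Fin 3 | l ≠ lab i} := by
      ext z
      simp only [SimpleGraph.mem_neighborSet, labelGraph, Set.mem_image, Set.mem_ofPred_eq]
      constructor
      · rintro ⟨j, l, hl, ⟨h1, h2⟩ | ⟨h1, h2⟩⟩
        · cases h1; exact ⟨l, hl, h2.symm⟩
        · cases h2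
      · rintro ⟨l, hl, rfl⟩
        exact ⟨i, l, hl, Or.inl ⟨rfl, rfl⟩⟩
    rw [h, Set.ncard_image_of_injective, Fin.ncard_ne]
    intro a b hab
    exact hτ (add_left_cancel (Sum.inr_injective hab))
  · obtain ⟨i₀, hi₀⟩ := hlab.2 y
    have h : (labelGraph τ lab).neighborSet (Sum.inr y)
        = (fun l => Sum.inl (y - τ l)) '' {l : Fin 3 | l ≠ lab i₀} := by
      ext z
      simp only [SimpleGraph.mem_neighborSet, labelGraph, Set.mem_image, Set.mem_ofPred_eq]
      constructor
      · rintro ⟨j, l, hl, ⟨h1, h2⟩ | ⟨h1, h2⟩⟩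
        · cases h1
        · have h3 : y = j + τ l := Sum.inr_injective h2
          refine ⟨l, ?_, by rw [h1, h3]; simp⟩
          rintro rfl
          have h4 : i₀ = j := by
            have : i₀ + τ (lab i₀) = j + τ (lab i₀) := hi₀.trans h3
            exact add_right_cancel this
          exact hl (by rw [h4])
      · rintro ⟨l, hl, rfl⟩
        refine ⟨y - τ l, l, ?_, Or.inr ⟨rfl, by simp⟩⟩
        intro h
        have h5 : y - τ l = i₀ := hlab.1 (by
          change y - τ l + τ (lab (y - τ l)) = i₀ + τ (lab i₀)
          rw [← h]
          exact (sub_add_cancel _ _).trans hi₀.symm)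
        exact hl (by rw [← h5]; exact h)
    rw [h, Set.ncard_image_of_injective, Fin.ncard_ne]
    intro a b hab
    exact hτ (sub_right_injective (Sum.inl_injective hab))

theorem SimpleGraph.isHamiltonian_of_ncard_neighborSet_eq_two {V : Type*} [Fintype V]
    [DecidableEq V] {F : SimpleGraph V} (hF : F.Connected)
    (h : ∀ x, (F.neighborSet x).ncard = 2) : F.IsHamiltonian := by
  intro _
  obtain ⟨v⟩ := hF.nonempty
  have hn : (F.neighborSet v).Nonempty := by
    rw [← Set.ncard_pos, h]; norm_num
  have hc : F.IsCycles := fun x _ => h x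
  obtain ⟨p, hp, hv⟩ := hc.exists_cycle_toSubgraph_verts_eq_connectedComponentSupp
    (c := F.connectedComponentMk v) rfl hn
  refine ⟨v, p, hp, ?_⟩
  refine hp.isPath_tail.isHamiltonian_of_mem fun w => ?_
  have hw : w ∈ p.support := by
    rw [← SimpleGraph.Walk.mem_verts_toSubgraph, hv]
    exact SimpleGraph.ConnectedComponent.sound (hF.preconnected w v)
  by_cases hwv : w = v
  · rw [hwv]; exact p.tail.end_mem_support
  · rw [SimpleGraph.Walk.support_tail_of_not_nil _ hp.not_nil]
    rw [SimpleGraph.Walk.mem_support_iff] at hw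
    exact hw.resolve_left hwv

theorem cyclicHaarGraph_isHamiltonian_of_labelGraph_connected {m : ℕ} [NeZero m]
    {S : Finset (ZMod m)} {τ : Fin 3 → ZMod m} {lab : ZMod m → Fin 3} (hS : ∀ l, τ l ∈ S)
    (hτ : Function.Injective τ) (hlab : Function.Bijective fun i => i + τ (lab i))
    (hconn : (labelGraph τ lab).Connected) : (cyclicHaarGraph m S).IsHamiltonian := by
  refine SimpleGraph.IsHamiltonian.mono (G := labelGraph τ lab) ?_
    (SimpleGraph.isHamiltonian_of_ncard_neighborSet_eq_two hconn (labelGraph_ncard_neighborSet hτ hlab))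
  rintro x y ⟨i, l, -, h⟩
  exact ⟨i, τ l, hS l, h⟩

/-! ### Parity of 3-edge-colourings and a second Hamilton cycle -/

open Equiv in
/-- Recolouring with the second and third colours exchanged off the component of `u_0`. -/
noncomputable def swapOffComponent {G : Type*} [AddCommGroup G] (τ : Fin 3 → G)
    (f : G → Perm (Fin 3)) : G → Perm (Fin 3) := by
  classical
  exact fun i => if (labelGraph τ fun j => f j 0).Reachable (Sum.inl 0) (Sum.inl i) then f i
    else f i * swap 1 2

section
open Equiv
variable {G : Type*} [AddCommGroup G] {τ : Fin 3 → G} {f : G → Perm (Fin 3)}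

theorem swapOffComponent_of_reachable {i : G}
    (h : (labelGraph τ fun j => f j 0).Reachable (Sum.inl 0) (Sum.inl i)) :
    swapOffComponent τ f i = f i := by
  simp [swapOffComponent, h]

theorem swapOffComponent_of_not_reachable {i : G}
    (h : ¬ (labelGraph τ fun j => f j 0).Reachable (Sum.inl 0) (Sum.inl i)) :
    swapOffComponent τ f i = f i * swap 1 2 := by
  simp [swapOffComponent, h]

theorem swapOffComponent_apply_zero (i : G) : swapOffComponent τ f i 0 = f i 0 := by
  by_cases h : (labelGraph τ fun j => f j 0).Reachable (Sum.inl 0) (Sum.inl i)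
  · rw [swapOffComponent_of_reachable h]
  · rw [swapOffComponent_of_not_reachable h, Perm.mul_apply,
      swap_apply_of_ne_of_ne (by decide) (by decide)]

theorem swapOffComponent_involutive : swapOffComponent τ (swapOffComponent τ f) = f := by
  funext i
  have h0 : (labelGraph τ fun j => swapOffComponent τ f j 0) = labelGraph τ fun j => f j 0 := by
    simp only [swapOffComponent_apply_zero]
  by_cases h : (labelGraph τ fun j => f j 0).Reachable (Sum.inl 0) (Sum.inl i)
  · rw [swapOffComponent_of_reachable (by rwa [h0]), swapOffComponent_of_reachable h]
  · rw [swapOffComponent_of_not_reachable (by rwa [h0]), swapOffComponent_of_not_reachable h,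
      mul_assoc, swap_mul_self, mul_one]

/-- If every `u_i` were in the component of `u_0`, a `v_y` outside it would have all three edges of
colour 0, which is not proper. So a disconnected graph has some `u_i` that gets recoloured. -/
theorem swapOffComponent_ne (hf : Function.Injective fun i => i + τ (f i 0))
    (h : ¬ (labelGraph τ fun j => f j 0).Connected) :
    swapOffComponent τ f ≠ f := by
  intro heq
  apply h
  have hu : ∀ i, (labelGraph τ fun j => f j 0).Reachable (Sum.inl 0) (Sum.inl i) := by
    intro i
    by_contra hi
    have h1 := congrFun heq i
    rw [swapOffComponent_of_not_reachable hi, mul_eq_left] at h1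
    exact absurd (congrArg (fun e : Perm (Fin 3) => e 1) h1) (by decide)
  have hv : ∀ y, (labelGraph τ fun j => f j 0).Reachable (Sum.inl 0) (Sum.inr y) := by
    intro y
    by_contra hy
    have key : ∀ l, f (y - τ l) 0 = l := by
      intro l
      by_contra hl
      refine hy ((hu (y - τ l)).trans (SimpleGraph.Adj.reachable ?_))
      have := labelGraph_adj (τ := τ) (lab := fun j => f j 0) (i := y - τ l) (l := l)
        (fun h => hl h.symm)
      simpa using this
    have h01 : y - τ 0 = y - τ 1 := hf (by simp only [key, sub_add_cancel])
    have := (key 0).symm.trans ((congrArg (fun i => f i 0) h01).trans (key 1))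
    exact absurd this (by decide)
  have : Nonempty (G ⊕ G) := ⟨Sum.inl 0⟩
  have hall : ∀ x, (labelGraph τ fun j => f j 0).Reachable (Sum.inl 0) x := by
    rintro (i | y)
    · exact hu i
    · exact hv y
  exact ⟨fun x y => (hall x).symm.trans (hall y)⟩

/-- Two edges of the same new colour 1 or 2 meeting at some `v_y` lie in one component, so both are
exchanged or both kept, and they already clashed before. -/
theorem swapOffComponent_injective
    (h : ∀ x, Function.Injective fun i => i + τ (f i x)) (x : Fin 3) :
    Function.Injective fun i => i + τ (swapOffComponent τ f i x) := by
  by_cases hx : x = 0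
  · subst hx
    simpa only [swapOffComponent_apply_zero] using h 0
  have hadj : ∀ i, (labelGraph τ fun j => f j 0).Reachable (Sum.inl i)
      (Sum.inr (i + τ (swapOffComponent τ f i x))) := by
    intro i
    refine (labelGraph_adj ?_).reachable
    rw [← swapOffComponent_apply_zero (τ := τ) (f := f) i]
    exact fun h => hx ((swapOffComponent τ f i).injective h)
  intro i j hij
  simp only at hij
  have hr : (labelGraph τ fun j => f j 0).Reachable (Sum.inl i) (Sum.inl j) := by
    have h1 := hadj i
    rw [hij] at h1
    exact h1.trans (hadj j).symm
  by_cases hi : (labelGraph τ fun j => f j 0).Reachable (Sum.inl 0) (Sum.inl i)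
  · rw [swapOffComponent_of_reachable hi, swapOffComponent_of_reachable (hi.trans hr)] at hij
    exact h x hij
  · have hj : ¬ (labelGraph τ fun j => f j 0).Reachable (Sum.inl 0) (Sum.inl j) :=
      fun hj => hi (hj.trans hr.symm)
    rw [swapOffComponent_of_not_reachable hi, swapOffComponent_of_not_reachable hj] at hij
    exact h (swap 1 2 x) hij
end

theorem ZMod.induction_add_one {n : ℕ} [NeZero n] {p : ZMod n → Prop} (h0 : p 0)
    (h : ∀ i, p i → p (i + 1)) (i : ZMod n) : p i := by
  have key : ∀ k : ℕ, p k := by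
    intro k
    induction k with
    | zero => simpa using h0
    | succ k ih => simpa using h _ ih
  simpa using key i.val

theorem labelGraph_const_two_connected {n : ℕ} [NeZero n] (c : ZMod n) :
    (labelGraph ![0, 1, c] fun _ => 2).Connected := by
  have e0 : ∀ i : ZMod n, (labelGraph ![0, 1, c] fun _ => 2).Reachable (Sum.inl i) (Sum.inr i) := by
    intro i
    simpa using (labelGraph_adj (τ := ![0, 1, c]) (lab := fun _ => 2) (i := i) (l := 0)
      (by decide)).reachable
  have e1 : ∀ i : ZMod n,
      (labelGraph ![0, 1, c] fun _ => 2).Reachable (Sum.inl i) (Sum.inr (i + 1)) := by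
    intro i
    simpa using (labelGraph_adj (τ := ![0, 1, c]) (lab := fun _ => 2) (i := i) (l := 1)
      (by decide)).reachable
  have hu : ∀ i : ZMod n,
      (labelGraph ![0, 1, c] fun _ => 2).Reachable (Sum.inl 0) (Sum.inl i) :=
    ZMod.induction_add_one (SimpleGraph.Reachable.refl _)
      fun i hi => (hi.trans (e1 i)).trans (e0 (i + 1)).symm
  have : Nonempty (ZMod n ⊕ ZMod n) := ⟨Sum.inl 0⟩
  have hall : ∀ x, (labelGraph ![0, 1, c] fun _ => 2).Reachable (Sum.inl (0 : ZMod n)) x := by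
    rintro (i | y)
    · exact hu i
    · exact (hu y).trans (e0 y)
  exact ⟨fun x y => (hall x).symm.trans (hall y)⟩

theorem Finset.sum_one_eq_zero_of_involution {ι : Type*} (s : Finset ι) (g : ι → ι)
    (hne : ∀ a ∈ s, g a ≠ a) (hmem : ∀ a ∈ s, g a ∈ s) (hg : ∀ a, g (g a) = a) :
    ∑ _a ∈ s, (1 : ZMod 2) = 0 :=
  Finset.sum_involution (fun a _ => g a) (fun _ _ => by decide) (fun a ha _ => hne a ha)
    (fun a ha => hmem a ha) (fun a _ => hg a)

open Equiv in
/-- Besides the cycle formed by the edges labelled `0` and `1`, the Haar graph with connection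
labels `0, 1, c` has a second Hamilton cycle. -/
theorem exists_second_label {n : ℕ} [NeZero n] (c : ZMod n) :
    ∃ lab : ZMod n → Fin 3, (Function.Bijective fun i => i + (![0, 1, c] : Fin 3 → ZMod n) (lab i)) ∧
      (labelGraph ![0, 1, c] lab).Connected ∧ ∃ t, lab t ≠ 2 := by
  classical
  by_contra! H
  set τ : Fin 3 → ZMod n := ![0, 1, c] with hτ
  -- `f i x` is the label of the edge of colour `x` at `u_i`. Fixing colour 1 on the label-0 edge at
  -- `u_0` leaves exactly one colouring for the known cycle.
  let X : Finset (ZMod n → Perm (Fin 3)) := Finset.univ.filter fun f =>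
    (∀ x, Function.Injective fun i => i + τ (f i x)) ∧ f 0 1 = 0
  have hX : ∀ f, f ∈ X ↔ (∀ x, Function.Injective fun i => i + τ (f i x)) ∧ f 0 1 = 0 := by
    intro f; simp [X]
  let conn : (ZMod n → Perm (Fin 3)) → Prop := fun f => (labelGraph τ fun j => f j 0).Connected
  have h1 : ∑ _f ∈ X, (1 : ZMod 2) = 0 := by
    refine X.sum_one_eq_zero_of_involution (fun f i => f i * swap 0 2) ?_ ?_ ?_
    · intro f _ h
      have h := congrFun h 0
      simp only [mul_eq_left] at h
      exact absurd (congrArg (fun e : Perm (Fin 3) => e 0) h) (by decide)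
    · intro f hf
      rw [hX] at hf ⊢
      refine ⟨fun x => hf.1 (swap 0 2 x), ?_⟩
      rw [Perm.mul_apply, swap_apply_of_ne_of_ne (by decide) (by decide), hf.2]
    · intro f
      funext i
      simp [mul_assoc]
  -- The exchange leaves `u_0` alone, so it stays within `X`.
  have h2 : ∑ _f ∈ X.filter (fun f => ¬ conn f), (1 : ZMod 2) = 0 := by
    refine (X.filter fun f => ¬ conn f).sum_one_eq_zero_of_involution (swapOffComponent τ) ?_ ?_ ?_
    · intro f hf
      rw [Finset.mem_filter, hX] at hf
      exact swapOffComponent_ne (hf.1.1 0) hf.2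
    · intro f hf
      rw [Finset.mem_filter, hX] at hf ⊢
      refine ⟨⟨swapOffComponent_injective hf.1.1, ?_⟩, ?_⟩
      · rw [swapOffComponent_of_reachable (SimpleGraph.Reachable.refl _), hf.1.2]
      · simpa only [conn, swapOffComponent_apply_zero] using hf.2
    · intro f
      exact swapOffComponent_involutive
  let σ : Perm (Fin 3) := (finRotate 3).symm
  have s0 : σ 0 = 2 := by decide
  have s1 : σ 1 = 0 := by decide
  have s2 : σ 2 = 1 := by decide
  -- With no second cycle, colour 0 is label 2 everywhere and the other colours alternate around the
  -- known cycle: a single colouring, while the two even counts force an even number.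
  have h3 : X.filter (fun f => conn f) = {fun _ => σ} := by
    ext f
    rw [Finset.mem_filter, Finset.mem_singleton, hX]
    constructor
    · rintro ⟨⟨hf, hf0⟩, hc⟩
      have hlab := H (fun i => f i 0) (Finite.injective_iff_bijective.1 (hf 0)) hc
      have h10 : ∀ i, f i 1 = 0 := by
        refine ZMod.induction_add_one hf0 fun i hi => ?_
        by_contra hne
        have hi2 : f i 2 = 1 := by
          have a1 : f i 2 ≠ f i 0 := fun h => absurd ((f i).injective h) (by decide)
          have a2 : f i 2 ≠ f i 1 := fun h => absurd ((f i).injective h) (by decide)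
          rw [hlab i] at a1
          rw [hi] at a2
          omega
        have hj2 : f (i + 1) 2 = 0 := by
          have a1 : f (i + 1) 2 ≠ f (i + 1) 0 := fun h => absurd ((f (i + 1)).injective h) (by decide)
          have a2 : f (i + 1) 2 ≠ f (i + 1) 1 := fun h => absurd ((f (i + 1)).injective h) (by decide)
          have a3 : f (i + 1) 1 ≠ f (i + 1) 0 := fun h => absurd ((f (i + 1)).injective h) (by decide)
          rw [hlab (i + 1)] at a1 a3
          omega
        -- Both `u_i` and `u_{i+1}` would send an edge of colour 2 to `v_{i+1}`.
        have h4 : i = i + 1 := by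
          apply hf 2
          simp [hi2, hj2, hτ]
        rw [← h4] at hne
        exact hne hi
      funext i
      ext x
      have a1 : f i 2 ≠ f i 0 := fun h => absurd ((f i).injective h) (by decide)
      have a2 : f i 2 ≠ f i 1 := fun h => absurd ((f i).injective h) (by decide)
      have a3 := h10 i
      have a4 := hlab i
      fin_cases x
      · simp only [Fin.zero_eta, a4, s0]
      · simp only [Fin.mk_one, a3, s1]
      · simp only [Fin.reduceFinMk, s2]
        omega
    · rintro rfl
      refine ⟨⟨fun x i j h => add_right_cancel h, s1⟩, ?_⟩
      exact labelGraph_const_two_connected c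
  have h4 := Finset.sum_filter_add_sum_filter_not X (fun f => conn f) (fun _ => (1 : ZMod 2))
  rw [h1, h2, h3] at h4
  simp at h4

/-! ### Lifting the second cycle through an odd number of columns -/

/-- Labels on column `j` of a stack of columns over `ZMod n`, extending `lab` on column `0`: every
two further columns shift the pattern of unused labels `2` by one. -/
def columnLabel {n : ℕ} (lab : ZMod n → Fin 3) : ℕ → ZMod n → Fin 3
  | 0, t => lab t
  | j + 1, t =>
    if Even j then (if lab (t + (j / 2 : ℕ)) = 2 then 2 else 0)
    else if lab (t + (j / 2 : ℕ) + 1) = 2 then 2 else 1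

theorem columnLabel_odd {n : ℕ} (lab : ZMod n → Fin 3) (l : ℕ) (t : ZMod n) :
    columnLabel lab (2 * l + 1) t = if lab (t + l) = 2 then 2 else 0 := by
  simp [columnLabel]

theorem columnLabel_even {n : ℕ} (lab : ZMod n → Fin 3) (l : ℕ) (t : ZMod n) :
    columnLabel lab (2 * l + 2) t = if lab (t + l + 1) = 2 then 2 else 1 := by
  have h1 : ¬ Even (2 * l + 1) := by simp
  have h2 : (2 * l + 1) / 2 = l := by omega
  simp only [columnLabel, h1, h2, if_false]

theorem columnLabel_even_eq_two {n : ℕ} (lab : ZMod n → Fin 3) (l : ℕ) (t : ZMod n) :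
    columnLabel lab (2 * l) t = 2 ↔ lab (t + l) = 2 := by
  cases l with
  | zero => simp [columnLabel]
  | succ l =>
    rw [show 2 * (l + 1) = 2 * l + 2 by ring, columnLabel_even]
    push_cast
    rw [← add_assoc]
    split_ifs with h <;> simp [h]

theorem columnLabel_odd_eq_two {n : ℕ} (lab : ZMod n → Fin 3) (l : ℕ) (t : ZMod n) :
    columnLabel lab (2 * l + 1) t = 2 ↔ lab (t + l) = 2 := by
  rw [columnLabel_odd]
  split_ifs with h <;> simp [h]

section
variable {G : Type*} [AddCommGroup G] {n : ℕ} {q : ℕ}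

theorem exists_columnLabel_add_eq {x b : G} {φ : ZMod n →+ G} {s c : ZMod n}
    {lab : ZMod n → Fin 3} {L : G → Fin 3} (hs : (2 * q + 1) • b = φ s) (hc : c = s - q)
    (hcol : ∀ y, ∃ j < 2 * q + 1, ∃ t, y = j • b + φ t)
    (hL : ∀ j < 2 * q + 1, ∀ t, L (j • b + φ t) = columnLabel lab j t)
    (hlab : Function.Surjective fun i => i + (![0, 1, c] : Fin 3 → ZMod n) (lab i)) :
    Function.Surjective fun i => i + (![x, x + φ 1, x + b] : Fin 3 → G) (L i) := by
  intro y
  obtain ⟨j, hj, t, hy⟩ := hcol (y - x)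
  have hy : y = x + (j • b + φ t) := by rw [← hy]; abel
  suffices h : ∃ j' < 2 * q + 1, ∃ t', j' • b + φ t' +
      (![x, x + φ 1, x + b] : Fin 3 → G) (columnLabel lab j' t') = y by
    obtain ⟨j', hj', t', h⟩ := h
    exact ⟨j' • b + φ t', by simpa only [hL j' hj'] using h⟩
  subst hy
  rcases Nat.even_or_odd' j with ⟨l, rfl | rfl⟩
  · rcases l with - | l
    · obtain ⟨t₀, ht₀⟩ := hlab t
      simp only at ht₀
      by_cases h2 : lab t₀ = 2
      -- A removed label-2 edge of the base graph becomes the wrap-around edge from the last column,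
      -- where the pattern has shifted by `q`.
      · refine ⟨2 * q, by omega, t₀ - q, ?_⟩
        rw [(columnLabel_even_eq_two lab q _).2 (by simpa using h2)]
        rw [h2] at ht₀
        have : φ t = φ (t₀ - q) + (2 * q + 1) • b := by
          rw [hs, ← map_add, ← ht₀]
          simp only [Matrix.cons_val, hc, map_add, map_sub]
          abel
        simp only [Matrix.cons_val, this, add_smul, one_smul, mul_zero, zero_smul]
        abel
      · refine ⟨0, by omega, t₀, ?_⟩
        have h01 : lab t₀ = 0 ∨ lab t₀ = 1 := by omega
        rcases h01 with h | h
        · rw [h] at ht₀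
          simp [columnLabel, h, ← ht₀, add_comm]
        · rw [h] at ht₀
          simp only [columnLabel, h, ← ht₀, Matrix.cons_val, map_add, mul_zero, zero_smul]
          abel
    · by_cases h2 : lab (t + l) = 2
      · refine ⟨2 * l + 1, by omega, t, ?_⟩
        rw [(columnLabel_odd_eq_two lab l t).2 h2]
        simp only [Matrix.cons_val, show 2 * (l + 1) = 2 * l + 1 + 1 by ring, succ_nsmul _ (2 * l + 1)]
        abel
      · refine ⟨2 * l + 2, by omega, t - 1, ?_⟩
        rw [columnLabel_even, if_neg (by rwa [show t - 1 + (l : ZMod n) + 1 = t + l by ring])]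
        simp only [Matrix.cons_val, show 2 * (l + 1) = 2 * l + 2 by ring, map_sub]
        abel
  · by_cases h2 : lab (t + l) = 2
    · refine ⟨2 * l, by omega, t, ?_⟩
      rw [(columnLabel_even_eq_two lab l t).2 h2]
      simp only [Matrix.cons_val, succ_nsmul _ (2 * l)]
      abel
    · refine ⟨2 * l + 1, by omega, t, ?_⟩
      rw [columnLabel_odd, if_neg h2]
      simp only [Matrix.cons_val]
      abel

theorem ZMod.exists_first_sub [NeZero n] {p : ZMod n → Prop} (hp : ∃ t, p t) (t : ZMod n) :
    ∃ d : ℕ, p (t - d - 1) ∧ ∀ e < d, ¬ p (t - e - 1) := by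
  classical
  have h : ∃ d : ℕ, p (t - d - 1) := by
    obtain ⟨t', h⟩ := hp
    exact ⟨(t - 1 - t').val, by rw [ZMod.natCast_zmod_val]; convert h using 1; ring⟩
  exact ⟨Nat.find h, Nat.find_spec h, fun e he => Nat.find_min h he⟩

theorem labelGraph_column_connected [NeZero n] {x b : G} {φ : ZMod n →+ G} {s c : ZMod n}
    {lab : ZMod n → Fin 3} {L : G → Fin 3} (hs : (2 * q + 1) • b = φ s) (hc : c = s - q)
    (hcol : ∀ y, ∃ j < 2 * q + 1, ∃ t, y = j • b + φ t)
    (hL : ∀ j < 2 * q + 1, ∀ t, L (j • b + φ t) = columnLabel lab j t)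
    (hconn : (labelGraph ![0, 1, c] lab).Connected) (hlab : ∃ t, lab t ≠ 2) :
    (labelGraph ![x, x + φ 1, x + b] L).Connected := by
  set F := labelGraph ![x, x + φ 1, x + b] L with hF
  let U : ℕ → ZMod n → G ⊕ G := fun j t => Sum.inl (j • b + φ t)
  let V : ℕ → ZMod n → G ⊕ G := fun j t => Sum.inr (x + (j • b + φ t))
  have e0 : ∀ j < 2 * q + 1, ∀ t, columnLabel lab j t ≠ 0 → F.Reachable (U j t) (V j t) := by
    intro j hj t h
    have := labelGraph_adj (τ := ![x, x + φ 1, x + b]) (lab := L) (i := j • b + φ t) (l := 0)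
      (by rw [hL j hj]; exact h.symm)
    convert this.reachable using 2
    simp [add_comm]
  have e1 : ∀ j < 2 * q + 1, ∀ t, columnLabel lab j t ≠ 1 →
      F.Reachable (U j t) (V j (t + 1)) := by
    intro j hj t h
    have := labelGraph_adj (τ := ![x, x + φ 1, x + b]) (lab := L) (i := j • b + φ t) (l := 1)
      (by rw [hL j hj]; exact h.symm)
    convert this.reachable using 2
    simp only [Matrix.cons_val, map_add]
    abel
  have e2 : ∀ j < 2 * q + 1, ∀ t, columnLabel lab j t ≠ 2 →
      F.Reachable (U j t) (V (j + 1) t) := by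
    intro j hj t h
    have := labelGraph_adj (τ := ![x, x + φ 1, x + b]) (lab := L) (i := j • b + φ t) (l := 2)
      (by rw [hL j hj]; exact h.symm)
    convert this.reachable using 2
    simp only [Matrix.cons_val, add_smul, one_smul]
    abel
  -- downward paths in odd columns, upward paths in even columns
  have down : ∀ l, 2 * l + 1 < 2 * q + 1 → ∀ t (d : ℕ), (∀ e < d, lab (t - e - 1 + l) = 2) →
      F.Reachable (V (2 * l + 1) t) (U (2 * l + 1) (t - d - 1)) := by
    intro l hl t d
    have h1 : ∀ t, F.Reachable (V (2 * l + 1) t) (U (2 * l + 1) (t - 1)) := by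
      intro t
      have := e1 _ hl (t - 1) (by rw [columnLabel_odd]; split_ifs <;> decide)
      rw [sub_add_cancel] at this
      exact this.symm
    induction d with
    | zero => intro _; simpa using h1 t
    | succ d ih =>
      intro h
      refine (ih fun e he => h e (by omega)).trans ?_
      have h3 := e0 _ hl (t - d - 1) (by
        rw [(columnLabel_odd_eq_two lab l _).2 (h d (by omega))]; decide)
      have h4 := h1 (t - d - 1)
      refine h3.trans ?_
      convert h4 using 2
      push_cast; ring
  have up : ∀ l, 2 * l + 2 < 2 * q + 1 → ∀ t (d : ℕ), (∀ e < d, lab (t - e - 1 + l) = 2) →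
      F.Reachable (V (2 * l + 2) (t - d - 1)) (U (2 * l + 2) (t - 1)) := by
    intro l hl t d
    have h1 : ∀ t, F.Reachable (V (2 * l + 2) t) (U (2 * l + 2) t) := by
      intro t
      exact (e0 _ hl t (by rw [columnLabel_even]; split_ifs <;> decide)).symm
    induction d with
    | zero => intro _; simpa using h1 (t - 1)
    | succ d ih =>
      intro h
      refine SimpleGraph.Reachable.trans ?_ (ih fun e he => h e (by omega))
      have h3 := e1 _ hl (t - (d + 1 : ℕ) - 1) (by
        rw [columnLabel_even, if_pos]
        · decide
        · convert h d (by omega) using 2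
          push_cast; ring)
      refine (h1 _).trans ?_
      convert h3 using 2
      push_cast; ring
  -- Each pair of columns is crossed by going down to the next level with a surviving label-2 edge,
  -- stepping over, and going back up to one level below the start. Some such level exists because
  -- `lab` is not constantly 2.
  have cross : ∀ l ≤ q, ∀ t, lab t ≠ 2 → F.Reachable (U 0 t) (U (2 * l) (t - l)) := by
    intro l
    induction l with
    | zero => intro _ t _; simp
    | succ l ih =>
      intro hl t ht
      refine (ih (by omega) t ht).trans ?_
      obtain ⟨d, hd, hd'⟩ := ZMod.exists_first_sub hlab t
      have a1 := e2 (2 * l) (by omega) (t - l) (by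
        rw [Ne, columnLabel_even_eq_two]; simpa using ht)
      have hd2 : ∀ e < d, lab (t - l - e - 1 + l) = 2 := by
        intro e he
        have := hd' e he
        rw [not_not] at this
        rw [← this]; congr 1; ring
      have a2 := down l (by omega) (t - l) d hd2
      have a3 := e2 (2 * l + 1) (by omega) (t - l - d - 1) (by
        rw [Ne, columnLabel_odd_eq_two]
        rwa [show t - l - d - 1 + (l : ZMod n) = t - d - 1 by ring])
      have a4 := up l (by omega) (t - l) d hd2
      refine ((a1.trans a2).trans (a3.trans a4)).trans ?_
      rw [show 2 * (l + 1) = 2 * l + 2 by ring,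
        show t - ((l + 1 : ℕ) : ZMod n) = t - l - 1 by push_cast; ring]
  -- all vertices of column `0` are joined
  let g : ZMod n ⊕ ZMod n → G ⊕ G := Sum.elim (U 0) (V 0)
  have hbase : ∀ v w, (labelGraph ![0, 1, c] lab).Adj v w → F.Reachable (g v) (g w) := by
    have key : ∀ i l, l ≠ lab i →
        F.Reachable (U 0 i) (V 0 (i + (![0, 1, c] : Fin 3 → ZMod n) l)) := by
      intro i l hl
      have h012 : l = 0 ∨ l = 1 ∨ l = 2 := by omega
      rcases h012 with rfl | rfl | rfl
      · simpa using e0 0 (by omega) i hl.symm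
      · simpa using e1 0 (by omega) i hl.symm
      -- Column `2q + 1` is column 0 shifted by `s`, so the path ends at `i - q + s = i + c`.
      · have a1 := cross q le_rfl i hl.symm
        have a2 := e2 (2 * q) (by omega) (i - q) (by
          rw [Ne, columnLabel_even_eq_two]; simpa using hl.symm)
        refine (a1.trans a2).trans ?_
        have : V (2 * q + 1) (i - q) = V 0 (i + (![0, 1, c] : Fin 3 → ZMod n) 2) := by
          simp only [V, hs, ← map_add, Matrix.cons_val, hc, zero_smul, zero_add]
          congr 3
          ring
        rw [this]
    rintro v w ⟨i, l, hl, ⟨rfl, rfl⟩ | ⟨rfl, rfl⟩⟩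
    · exact key i l hl
    · exact (key i l hl).symm
  have hcol0 : ∀ v w, F.Reachable (g v) (g w) := by
    intro v w
    obtain ⟨p⟩ := hconn.preconnected v w
    induction p with
    | nil => exact SimpleGraph.Reachable.refl _
    | cons h _ ih => exact (hbase _ _ h).trans ih
  have hV : ∀ j < 2 * q + 1, ∀ t, F.Reachable (U 0 0) (V j t) ∧ F.Reachable (U 0 0) (U j t) := by
    intro j
    induction j with
    | zero => exact fun _ t => ⟨hcol0 (Sum.inl 0) (Sum.inr t), hcol0 (Sum.inl 0) (Sum.inl t)⟩
    | succ j ih =>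
      intro hj
      obtain ⟨t₀, ht₀⟩ := hlab
      rcases Nat.even_or_odd' j with ⟨l, rfl | rfl⟩
      · have hUV : ∀ t, F.Reachable (U (2 * l + 1) t) (V (2 * l + 1) (t + 1)) := fun t =>
          e1 _ hj t (by rw [columnLabel_odd]; split_ifs <;> decide)
        have hent : ∀ t, lab (t + l) ≠ 2 → F.Reachable (U 0 0) (V (2 * l + 1) t) := fun t ht =>
          (ih (by omega) t).2.trans (e2 _ (by omega) t (by rwa [Ne, columnLabel_even_eq_two]))
        have hall : ∀ i, F.Reachable (U 0 0) (V (2 * l + 1) (t₀ - l - i)) := by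
          refine ZMod.induction_add_one (hent _ (by simpa using ht₀)) fun i hi => ?_
          by_cases h : lab (t₀ - l - (i + 1) + l) = 2
          · have h1 := hUV (t₀ - l - (i + 1))
            rw [show t₀ - l - (i + 1) + 1 = t₀ - l - i by ring] at h1
            exact (hi.trans h1.symm).trans (e0 _ hj _ (by
              rw [(columnLabel_odd_eq_two lab l _).2 h]; decide))
          · exact hent _ h
        have hall' : ∀ t, F.Reachable (U 0 0) (V (2 * l + 1) t) := fun t => by
          simpa using hall (t₀ - l - t)
        exact fun t => ⟨hall' t, (hall' _).trans (hUV t).symm⟩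
      · have hUV : ∀ t, F.Reachable (U (2 * l + 2) t) (V (2 * l + 2) t) := fun t =>
          e0 _ hj t (by rw [columnLabel_even]; split_ifs <;> decide)
        have hent : ∀ t, lab (t + l) ≠ 2 → F.Reachable (U 0 0) (V (2 * l + 2) t) := fun t ht =>
          (ih (by omega) t).2.trans (e2 _ (by omega) t (by rwa [Ne, columnLabel_odd_eq_two]))
        have hall : ∀ i, F.Reachable (U 0 0) (V (2 * l + 2) (t₀ - l + i)) := by
          refine ZMod.induction_add_one (hent _ (by simpa using ht₀)) fun i hi => ?_
          by_cases h : lab (t₀ - l + (i + 1) + l) = 2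
          · have h1 := e1 _ hj (t₀ - l + i) (by
              rw [columnLabel_even, if_pos]
              · decide
              · convert h using 2; ring)
            rw [add_assoc (t₀ - (l : ZMod n)) i 1] at h1
            exact (hi.trans (hUV _).symm).trans h1
          · exact hent _ h
        have hall' : ∀ t, F.Reachable (U 0 0) (V (2 * l + 2) t) := fun t => by
          simpa using hall (t - (t₀ - l))
        exact fun t => ⟨hall' t, (hall' _).trans (hUV t).symm⟩
  have : Nonempty (G ⊕ G) := ⟨Sum.inl 0⟩
  have hall : ∀ v, F.Reachable (U 0 0) v := by
    rintro (y | y)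
    · obtain ⟨j, hj, t, rfl⟩ := hcol y
      exact (hV j hj t).2
    · obtain ⟨j, hj, t, h⟩ := hcol (y - x)
      have := (hV j hj t).1
      simp only [V, ← h, add_sub_cancel] at this
      exact this
  exact ⟨fun v w => (hall v).symm.trans (hall w)⟩
end

/-- Division with remainder by the index gives surjectivity, since that multiple of `b` lies in
`⟨a⟩`; counting does the rest. -/
theorem exists_columns {G : Type*} [AddCommGroup G] [Finite G] {a b : G}
    (hgen : AddSubgroup.zmultiples a ⊔ AddSubgroup.zmultiples b = ⊤) :
    ∃ φ : ZMod (addOrderOf a) →+ G, φ 1 = a ∧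
      (∃ s, (AddSubgroup.zmultiples a).index • b = φ s) ∧
      Function.Bijective fun p : Fin (AddSubgroup.zmultiples a).index × ZMod (addOrderOf a) =>
        p.1.val • b + φ p.2 := by
  set H := AddSubgroup.zmultiples a with hH
  set k := H.index with hk
  set n := addOrderOf a with hn
  have : NeZero n := ⟨(addOrderOf_pos a).ne'⟩
  have hk0 : k ≠ 0 := AddSubgroup.index_ne_zero_of_finite
  let φ : ZMod n →+ G := ZMod.lift n ⟨zmultiplesHom G a, by simp [hn]⟩
  have hφ : ∀ z : ℤ, φ z = z • a := fun z => by simp [φ]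
  have hφ1 : φ 1 = a := by simpa using hφ 1
  have hφH : ∀ y ∈ H, ∃ t, φ t = y := by
    rintro y ⟨z, rfl⟩
    exact ⟨z, hφ z⟩
  have hkb : k • b ∈ H := AddSubgroup.nsmul_index_mem H b
  obtain ⟨s, hs⟩ := hφH _ hkb
  refine ⟨φ, hφ1, ⟨s, hs.symm⟩, ?_⟩
  rw [Nat.bijective_iff_surjective_and_card]
  constructor
  · intro y
    have hy : y ∈ H ⊔ AddSubgroup.zmultiples b := hgen ▸ AddSubgroup.mem_top y
    obtain ⟨h, hh, -, ⟨w, rfl⟩, rfl⟩ := AddSubgroup.mem_sup.1 hy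
    have hkpos : (0 : ℤ) < k := by exact_mod_cast Nat.pos_of_ne_zero hk0
    have hw0 := Int.emod_nonneg w hkpos.ne'
    have hw1 := Int.emod_lt_of_pos w hkpos
    have hrest : h + (w / k) • (k • b) ∈ H := H.add_mem hh (H.zsmul_mem hkb _)
    obtain ⟨t, ht⟩ := hφH _ hrest
    refine ⟨(⟨(w % k).toNat, by omega⟩, t), ?_⟩
    have h1 : (w % k).toNat • b = (w % k) • b := by
      rw [← natCast_zsmul, Int.toNat_of_nonneg hw0]
    have h2 : w • b = (w % k) • b + (w / k) • (k • b) := by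
      rw [← natCast_zsmul, smul_smul, ← add_smul]
      congr 1
      rw [mul_comm]
      exact (Int.emod_add_mul_ediv w k).symm
    simp only [h1, ht, h2]
    abel
  · rw [Nat.card_prod, Nat.card_fin, Nat.card_zmod, hn, ← Nat.card_zmultiples]
    exact AddSubgroup.index_mul_card H

theorem cyclicHaarGraph_isHamiltonian_of_odd_index {m : ℕ} [NeZero m] {S : Finset (ZMod m)}
    {x a b : ZMod m} (hx : x ∈ S) (hxa : x + a ∈ S) (hxb : x + b ∈ S) (ha : a ≠ 0) (hb : b ≠ 0)
    (hab : a ≠ b) (hodd : Odd (AddSubgroup.zmultiples a).index)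
    (hgen : AddSubgroup.zmultiples a ⊔ AddSubgroup.zmultiples b = ⊤) :
    (cyclicHaarGraph m S).IsHamiltonian := by
  obtain ⟨φ, hφ, ⟨s, hs⟩, hbij⟩ := exists_columns hgen
  obtain ⟨q, hq⟩ := hodd
  have : NeZero (addOrderOf a) := ⟨(addOrderOf_pos a).ne'⟩
  generalize (AddSubgroup.zmultiples a).index = k at *
  subst hq
  obtain ⟨lab, hlab, hconn, htwo⟩ := exists_second_label (s - (q : ZMod (addOrderOf a)))
  let e := Equiv.ofBijective _ hbij
  have he : ∀ p, e p = p.1.val • b + φ p.2 := fun p => rfl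
  let L : ZMod m → Fin 3 := fun y => columnLabel lab (e.symm y).1.val (e.symm y).2
  have hcol : ∀ y, ∃ j < 2 * q + 1, ∃ t, y = j • b + φ t := fun y =>
    ⟨(e.symm y).1.val, (e.symm y).1.isLt, (e.symm y).2, by rw [← he, e.apply_symm_apply]⟩
  have hL : ∀ j < 2 * q + 1, ∀ t, L (j • b + φ t) = columnLabel lab j t := by
    intro j hj t
    have h1 : e.symm (j • b + φ t) = (⟨j, hj⟩, t) := by
      rw [Equiv.symm_apply_eq, he]
    simp only [L, h1]
  refine cyclicHaarGraph_isHamiltonian_of_labelGraph_connected (τ := ![x, x + φ 1, x + b])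
    (lab := L) ?_ ?_ ?_ (labelGraph_column_connected hs rfl hcol hL hconn htwo)
  · rw [hφ]
    intro l
    fin_cases l <;> simpa
  · rw [hφ]
    have h01 : x ≠ x + a := by simpa using ha
    have h02 : x ≠ x + b := by simpa using hb
    have h12 : x + a ≠ x + b := fun h => hab (add_left_cancel h)
    intro i j hij
    fin_cases i <;> fin_cases j
    exacts [rfl, absurd hij h01, absurd hij h02, absurd hij.symm h01, rfl, absurd hij h12,
      absurd hij.symm h02, absurd hij.symm h12, rfl]
  · exact Finite.surjective_iff_bijective.1
      (exists_columnLabel_add_eq hs rfl hcol hL hlab.surjective)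

/-! ### Choosing three elements of `S` -/

theorem index_zmultiples_zmod {m : ℕ} [NeZero m] (g : ZMod m) :
    (AddSubgroup.zmultiples g).index = m.gcd g.val := by
  have h1 := AddSubgroup.index_mul_card (AddSubgroup.zmultiples g)
  have h2 := ZMod.addOrderOf_coe g.val (NeZero.ne m)
  rw [ZMod.natCast_zmod_val] at h2
  rw [Nat.card_zmultiples, h2, Nat.card_zmod] at h1
  have h3 : m / m.gcd g.val * m.gcd g.val = m := Nat.div_mul_cancel (Nat.gcd_dvd_left _ _)
  have h4 : 0 < m / m.gcd g.val :=
    Nat.div_pos (Nat.le_of_dvd (NeZero.pos m) (Nat.gcd_dvd_left _ _))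
      (Nat.gcd_pos_of_pos_left _ (NeZero.pos m))
  refine Nat.eq_of_mul_eq_mul_right h4 ?_
  rw [h1, mul_comm, h3]

theorem castHom_eq_zero_of_dvd_index {m p : ℕ} [NeZero m] {g : ZMod m} (hp : p ∣ m)
    (h : p ∣ (AddSubgroup.zmultiples g).index) : ZMod.castHom hp (ZMod p) g = 0 := by
  rw [index_zmultiples_zmod] at h
  have h1 := h.trans (Nat.gcd_dvd_right _ _)
  rw [← ZMod.natCast_zmod_val g, map_natCast]
  exact (ZMod.natCast_eq_zero_iff _ _).2 h1

/-- The join is cyclic; a prime dividing its index would kill both `a` and `b`. -/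
theorem zmultiples_sup_eq_top {m : ℕ} [NeZero m] {a b : ZMod m}
    (h : ∀ p (hp : p ∣ m), p.Prime →
      ZMod.castHom hp (ZMod p) a ≠ 0 ∨ ZMod.castHom hp (ZMod p) b ≠ 0) :
    AddSubgroup.zmultiples a ⊔ AddSubgroup.zmultiples b = ⊤ := by
  obtain ⟨g, hg⟩ := (AddSubgroup.isAddCyclic_iff_exists_zmultiples_eq_top _).1
    (inferInstance : IsAddCyclic (AddSubgroup.zmultiples a ⊔ AddSubgroup.zmultiples b : AddSubgroup (ZMod m)))
  rw [← hg, ← AddSubgroup.index_eq_one]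
  by_contra hne
  obtain ⟨p, hp, hpi⟩ := Nat.exists_prime_and_dvd hne
  have hpm : p ∣ m := by
    have h1 := AddSubgroup.index_dvd_card (AddSubgroup.zmultiples g)
    rw [Nat.card_zmod] at h1
    exact hpi.trans h1
  have h0 := castHom_eq_zero_of_dvd_index hpm hpi
  have hmem : ∀ y ∈ AddSubgroup.zmultiples g, ZMod.castHom hpm (ZMod p) y = 0 := by
    intro y hy
    obtain ⟨z, rfl⟩ := AddSubgroup.mem_zmultiples_iff.1 hy
    simp only [map_zsmul, h0, smul_zero]
  rcases h p hpm hp with h1 | h1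
  · exact h1 (hmem a (hg ▸ AddSubgroup.mem_sup_left (AddSubgroup.mem_zmultiples a)))
  · exact h1 (hmem b (hg ▸ AddSubgroup.mem_sup_right (AddSubgroup.mem_zmultiples b)))

theorem cyclicHaarGraph_exists_castHom_ne {m p : ℕ} {S : Finset (ZMod m)}
    (hconn : (cyclicHaarGraph m S).Connected) (hp : p ∣ m) (hp1 : p.Prime) :
    ∃ x ∈ S, ∃ y ∈ S, ZMod.castHom hp (ZMod p) x ≠ ZMod.castHom hp (ZMod p) y := by
  by_contra! h
  set f := ZMod.castHom hp (ZMod p)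
  have : Fact p.Prime := ⟨hp1⟩
  obtain ⟨r, hr⟩ : ∃ r, ∀ x ∈ S, f x = r := by
    rcases S.eq_empty_or_nonempty with rfl | ⟨x, hx⟩
    · exact ⟨0, by simp⟩
    · exact ⟨f x, fun y hy => h y hy x hx⟩
  -- If `S` were constantly `r` modulo `p`, this map would be constant along edges, yet it separates
  -- `u_0` from `u_1`.
  let g : ZMod m ⊕ ZMod m → ZMod p := Sum.elim f fun i => f i - r
  have key : ∀ v w, g v = g w := by
    intro v w
    obtain ⟨P⟩ := hconn.preconnected v w
    induction P with
    | nil => rfl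
    | cons hadj _ ih =>
      rw [← ih]
      obtain ⟨i, c, hc, ⟨rfl, rfl⟩ | ⟨rfl, rfl⟩⟩ := hadj <;> simp [g, hr c hc]
  have := key (Sum.inl 0) (Sum.inl 1)
  simp [g] at this

theorem exists_pair_ne_and_ne {α β γ : Type*} {S : Set α} {f : α → β} {g : α → γ}
    (hf : ∃ x ∈ S, ∃ y ∈ S, f x ≠ f y) (hg : ∃ x ∈ S, ∃ y ∈ S, g x ≠ g y) :
    ∃ x ∈ S, ∃ y ∈ S, f x ≠ f y ∧ g x ≠ g y := by
  obtain ⟨x, hx, y, hy, hxy⟩ := hf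
  by_cases h : g x = g y
  · obtain ⟨z, hz, hzx⟩ : ∃ z ∈ S, g z ≠ g x := by
      by_contra! hc
      obtain ⟨u, hu, v, hv, huv⟩ := hg
      exact huv ((hc u hu).trans (hc v hv).symm)
    by_cases h1 : f z = f x
    · exact ⟨z, hz, y, hy, h1 ▸ hxy, h ▸ hzx⟩
    · exact ⟨z, hz, x, hx, h1, hzx⟩
  · exact ⟨x, hx, y, hy, hxy, h⟩

theorem IsProductOfAtMostThreePrimePowers.exists_primes {m : ℕ} [NeZero m] (h1 : m ≠ 1)
    (hm : IsProductOfAtMostThreePrimePowers m) :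
    ∃ p q r : ℕ, (p.Prime ∧ p ∣ m) ∧ (q.Prime ∧ q ∣ m) ∧ (r.Prime ∧ r ∣ m) ∧
      (2 ∣ m → p = 2) ∧ ∀ l : ℕ, l.Prime → l ∣ m → l = p ∨ l = q ∨ l = r := by
  obtain ⟨L, hL, hpp, rfl⟩ := hm
  have hcard : L.prod.primeFactors.card ≤ 3 := by
    have hsub : L.prod.primeFactors ⊆ (L.map Nat.minFac).toFinset := by
      intro l hl
      obtain ⟨hl, hd, -⟩ := Nat.mem_primeFactors.1 hl
      obtain ⟨t, ht, hlt⟩ := hl.prime.exists_mem_multiset_dvd hd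
      rw [Multiset.mem_toFinset, Multiset.mem_map]
      refine ⟨t, ht, ?_⟩
      obtain ⟨r, k, hr, hk, rfl⟩ := (isPrimePow_nat_iff t).1 (hpp t ht)
      have hlr := (Nat.prime_dvd_prime_iff_eq hl hr).1 (hl.dvd_of_dvd_pow hlt)
      rw [hlr, hr.pow_minFac hk.ne']
    exact (Finset.card_le_card hsub).trans
      ((Multiset.toFinset_card_le _).trans (by simpa using hL))
  generalize L.prod = m at *
  have hmem : ∀ l, l ∈ m.primeFactors ↔ l.Prime ∧ l ∣ m := fun l => by
    simp [Nat.mem_primeFactors, NeZero.ne m]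
  obtain ⟨p, hp, hp2⟩ : ∃ p ∈ m.primeFactors, 2 ∣ m → p = 2 := by
    by_cases h2 : 2 ∣ m
    · exact ⟨2, (hmem 2).2 ⟨Nat.prime_two, h2⟩, fun _ => rfl⟩
    · exact ⟨m.minFac, (hmem _).2 ⟨Nat.minFac_prime h1, m.minFac_dvd⟩, fun h => absurd h h2⟩
  suffices h : ∃ q ∈ m.primeFactors, ∃ r ∈ m.primeFactors, ∀ l ∈ m.primeFactors,
      l = p ∨ l = q ∨ l = r by
    obtain ⟨q, hq, r, hr, h⟩ := h
    exact ⟨p, q, r, (hmem p).1 hp, (hmem q).1 hq, (hmem r).1 hr, hp2,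
      fun l h3 h4 => h l ((hmem l).2 ⟨h3, h4⟩)⟩
  generalize m.primeFactors = Q at *
  have hc1 := Finset.card_erase_of_mem hp
  rcases (Q.erase p).eq_empty_or_nonempty with h | ⟨q, hq⟩
  · refine ⟨p, hp, p, hp, fun l hl => ?_⟩
    by_contra hne
    have : l ∈ Q.erase p := Finset.mem_erase.2 ⟨by tauto, hl⟩
    simp [h] at this
  have hc2 := Finset.card_erase_of_mem hq
  have hqQ := Finset.mem_of_mem_erase hq
  rcases ((Q.erase p).erase q).eq_empty_or_nonempty with h | ⟨r, hr⟩
  · refine ⟨q, hqQ, q, hqQ, fun l hl => ?_⟩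
    by_contra hne
    have : l ∈ (Q.erase p).erase q :=
      Finset.mem_erase.2 ⟨by tauto, Finset.mem_erase.2 ⟨by tauto, hl⟩⟩
    simp [h] at this
  · refine ⟨q, hqQ, r, Finset.mem_of_mem_erase (Finset.mem_of_mem_erase hr), fun l hl => ?_⟩
    by_contra! hne
    have hl' : l ∈ (Q.erase p).erase q :=
      Finset.mem_erase.2 ⟨hne.2.1, Finset.mem_erase.2 ⟨hne.1, hl⟩⟩
    exact hne.2.2 (Finset.card_le_one.1 (by omega) l hl' r hr)

theorem mainTheorem3 (m : ℕ) [NeZero m] (S : Finset (ZMod m)) (hS : 4 ≤ S.card)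
    (hconn : (cyclicHaarGraph m S).Connected) (hm : IsProductOfAtMostThreePrimePowers m) :
    (cyclicHaarGraph m S).IsHamiltonian := by
  have hcard : S.card ≤ m := (Finset.card_le_univ S).trans (ZMod.card m).le
  obtain ⟨p, q, r, ⟨hp, hpm⟩, ⟨hq, hqm⟩, ⟨hr, hrm⟩, h2, hall⟩ := hm.exists_primes (by omega)
  obtain ⟨x, hx, y, hy, hxyp, hxyq⟩ := exists_pair_ne_and_ne (S := (S : Set (ZMod m)))
    (cyclicHaarGraph_exists_castHom_ne hconn hpm hp)
    (cyclicHaarGraph_exists_castHom_ne hconn hqm hq)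
  have hxy : x ≠ y := fun h => hxyp (by rw [h])
  obtain ⟨z, hz, hzx, hzy, hzr⟩ : ∃ z ∈ S, z ≠ x ∧ z ≠ y ∧
      (ZMod.castHom hrm (ZMod r) y ≠ ZMod.castHom hrm (ZMod r) x ∨
        ZMod.castHom hrm (ZMod r) z ≠ ZMod.castHom hrm (ZMod r) x) := by
    by_cases hr0 : ZMod.castHom hrm (ZMod r) y = ZMod.castHom hrm (ZMod r) x
    · obtain ⟨u, hu, v, hv, huv⟩ := cyclicHaarGraph_exists_castHom_ne hconn hrm hr
      obtain ⟨z, hz, hzx⟩ : ∃ z ∈ S,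
          ZMod.castHom hrm (ZMod r) z ≠ ZMod.castHom hrm (ZMod r) x := by
        by_contra! hc
        exact huv ((hc u hu).trans (hc v hv).symm)
      exact ⟨z, hz, fun h => hzx (by rw [h]), fun h => hzx (by rw [h, hr0]), Or.inr hzx⟩
    · obtain ⟨z, hz, hne⟩ := Finset.exists_mem_notMem_of_card_lt_card
        (s := {x, y}) (t := S) ((Finset.card_le_two).trans_lt (by omega))
      simp only [Finset.mem_insert, Finset.mem_singleton, not_or] at hne
      exact ⟨z, hz, hne.1, hne.2, Or.inl hr0⟩
  refine cyclicHaarGraph_isHamiltonian_of_odd_index (x := x) (a := y - x) (b := z - x) hx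
    (by simpa using hy) (by simpa using hz) (sub_ne_zero.2 hxy.symm) (sub_ne_zero.2 hzx)
    (fun h => hzy (sub_left_injective h).symm) ?_ (zmultiples_sup_eq_top ?_)
  -- An even index forces `p = 2`, but `y - x` is nonzero modulo `p`.
  · rw [← Nat.not_even_iff_odd, even_iff_two_dvd]
    intro hdvd
    have h2m : 2 ∣ m := by
      have h1 := AddSubgroup.index_dvd_card (AddSubgroup.zmultiples (y - x))
      rw [Nat.card_zmod] at h1
      exact hdvd.trans h1
    obtain rfl := h2 h2m
    have h0 := castHom_eq_zero_of_dvd_index hpm hdvd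
    rw [map_sub, sub_eq_zero] at h0
    exact hxyp h0.symm
  · intro l hlm hl
    rw [map_sub, map_sub, sub_ne_zero, sub_ne_zero]
    rcases hall l hl hlm with rfl | rfl | rfl
    · exact Or.inl hxyp.symm
    · exact Or.inl hxyq.symm
    · exact hzr
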